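/- Let $q_0,q_1,q_2$ be the vertices of an equilateral triangle in $\mathbb R^2$, let $c_0,\dots,c_5$ be the three vertices and the three midpoints of the sides, and let $F_i(x)=\frac13x+\frac23c_i$, $0\le i\le5$. Let $K=SG_3$ be the attractor of $\{F_0,\dots,F_5\}$ (the nonempty compact set with $K=\bigcup_iF_i(K)$), and let $\mu$ be the standard measure on $K$, i.e. the Borel probability measure with $\mu(A)=\frac16\sum_i\mu(F_i^{-1}(A))$. Put $V_0=\{q_0,q_1,q_2\}$ and $V_{m+1}=\bigcup_iF_i(V_m)$. Let $G_0$ be the complete graph on $V_0$ and let $G_{m+1}$ be the union of the images of $G_m$ under the $F_i$; write $x\sim_m y$ if $x,y$ are adjacent in $G_m$, and let $\deg_m(x)$ be the number of neighbours of $x$ in $G_m$. Define $$\Delta_mu(x)=\frac1{\deg_m(x)}\sum_{y\sim_mx}(u(y)-u(x)),\qquad E_m(u,v)=\frac12\sum_{x\in V_m}\sum_{y\sim_mx}(u(x)-u(y))(v(x)-v(y)).$$ Let $r$ be the energy renormalization factor, $r=\frac12\inf\{E_1(w,w): w(q_0)=1,\ w(q_1)=w(q_2)=0\}$, the ratio of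 the level-one energy of the harmonic extension of the boundary values $1,0,0$ to their level-zero energy $2$. Let $\mathcal E(u,v)=\lim_{m\to\infty}r^{-m}E_m(u,v)$, let $\operatorname{dom}\mathcal E$ be the set of continuous $u:K\to\mathbb R$ with $\mathcal E(u,u)<\infty$, and let $\operatorname{dom}_0\mathcal E$ be the set of those that vanish on $V_0$. For $u\in\operatorname{dom}\mathcal E$ and $f$ continuous on $K$, say that $u\in\operatorname{dom}\Delta_\mu$ with $\Delta_\mu u=f$ if $\mathcal E(u,v)=-\int_Kfv\,d\mu$ for all $v\in\operatorname{dom}_0\mathcal E$. Theorem. Let $u\in\operatorname{dom}\Delta_\mu$ and $x\in K$. Then $$\Delta_\mu u(x)=6\lim_{m\to\infty}\left(\frac{90}7\right)^m\Delta_mu(x_m)$$ (in particular the limit exists) for every sequence $(x_m)_{m\ge0}$ with $x_m\in V_m$ for all $m$, $x_m\notin V_0$ for all large $m$, and $\lim_{m\to\infty}x_m=x$. -/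

import Mathlib

open Filter Topology MeasureTheory

noncomputable section

namespace SG3

/-- The Euclidean plane. -/
abbrev Plane : Type := EuclideanSpace ℝ (Fin 2)

/-- The vertices `q 0, q 1, q 2` of an equilateral triangle of side one. -/
def q : Fin 3 → Plane :=
  ![!₂[(1 : ℝ) / 2, Real.sqrt 3 / 2], !₂[(0 : ℝ), 0], !₂[(1 : ℝ), 0]]

/-- The fixed points of the six contractions: the three vertices of the triangle and the
midpoints of its three sides. -/
def center : Fin 6 → Plane :=
  ![q 0, q 1, q 2, midpoint ℝ (q 1) (q 2), midpoint ℝ (q 0) (q 2), midpoint ℝ (q 0) (q 1)]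

/-- The six contractions of ratio `1/3` that generate the level-3 Sierpinski gasket. They map
the triangle onto the six upward triangles of side `1/3` in its subdivision into nine. -/
def F (i : Fin 6) (x : Plane) : Plane := (1 / 3 : ℝ) • x + (2 / 3 : ℝ) • center i

/-- The coding map, `address w = lim_n F (w 0) (F (w 1) (… (F (w n) x) …))`, written as a
convergent series. -/
def address (w : ℕ → Fin 6) : Plane :=
  ∑' n : ℕ, (1 / 3 : ℝ) ^ n • ((2 / 3 : ℝ) • center (w n))

/-- The level-3 Sierpinski gasket, the attractor of the six maps `F i`
(see `isCompact_gasket`, `gasket_nonempty` and `gasket_eq_iUnion`). -/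
def gasket : Set Plane := Set.range address

/-- The standard self-similar measure, which gives each `m`-cell the mass `6⁻ᵐ`: the image of
the uniform Bernoulli measure under the coding map (see `standardMeasure_apply`). -/
def standardMeasure : Measure Plane :=
  (Measure.infinitePi fun _ : ℕ => (PMF.uniformOfFintype (Fin 6)).toMeasure).map address

open Classical in
/-- The vertex sets `V 0 ⊆ V 1 ⊆ …` of the approximating graphs; `V 0` is the boundary of the
gasket. -/
def V : ℕ → Finset Plane
  | 0 => Finset.univ.image q
  | m + 1 => Finset.univ.biUnion fun i : Fin 6 => (V m).image (F i)

/-- The edge relations of the approximating graphs: the complete graph on `V 0`, and then the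
images under the six maps of the graph of the level before. -/
def Adj : ℕ → Plane → Plane → Prop
  | 0, x, y => x ∈ V 0 ∧ y ∈ V 0 ∧ x ≠ y
  | m + 1, x, y => ∃ (i : Fin 6) (x' y' : Plane), Adj m x' y' ∧ F i x' = x ∧ F i y' = y

open Classical in
/-- The `m`-level neighbours of `x`. -/
def neighbors (m : ℕ) (x : Plane) : Finset Plane := (V m).filter (Adj m x)

/-- The number of `m`-level neighbours of `x`: `4` or `6` for `x ∈ V m \ V 0`. -/
def deg (m : ℕ) (x : Plane) : ℕ := (neighbors m x).card

/-- The degree-normalized graph Laplacian. -/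
def graphLaplacian (m : ℕ) (u : Plane → ℝ) (x : Plane) : ℝ :=
  (1 / (deg m x : ℝ)) * ∑ y ∈ neighbors m x, (u y - u x)

/-- The graph energy form of level `m` with unit conductances. -/
def graphEnergy (m : ℕ) (u v : Plane → ℝ) : ℝ :=
  (1 / 2) * ∑ x ∈ V m, ∑ y ∈ neighbors m x, (u x - u y) * (v x - v y)

/-- The boundary values `1, 0, 0`. -/
def HasUnitBoundaryValues (w : Plane → ℝ) : Prop := w (q 0) = 1 ∧ w (q 1) = 0 ∧ w (q 2) = 0

/-- The energy renormalization factor `r`: the factor by which the level-zero energy of the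
boundary values `1, 0, 0`, which is `1 + 1 = 2`, is multiplied on passing to the level-one
energy of their harmonic (energy-minimizing) extension. -/
def renormFactor : ℝ :=
  sInf {e : ℝ | ∃ w : Plane → ℝ, HasUnitBoundaryValues w ∧ e = graphEnergy 1 w w} / 2

/-- The renormalized energy form of level `m`. -/
def renormEnergy (m : ℕ) (u v : Plane → ℝ) : ℝ := (renormFactor ^ m)⁻¹ * graphEnergy m u v

/-- The self-similar energy form, to be used for `u`, `v` of finite energy. -/
def energy (u v : Plane → ℝ) : ℝ := limUnder atTop fun m => renormEnergy m u v

/-- The continuous functions of finite energy on the gasket. Functions on the gasket are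
represented by functions on the plane; their values off the gasket play no role. -/
def DomEnergy (u : Plane → ℝ) : Prop :=
  ContinuousOn u gasket ∧ ∃ e : ℝ, Tendsto (fun m => renormEnergy m u u) atTop (𝓝 e)

/-- The functions of finite energy that vanish on the boundary `V 0`. -/
def DomEnergyZero (v : Plane → ℝ) : Prop := DomEnergy v ∧ ∀ p ∈ V 0, v p = 0

/-- `u` is in the domain of the Laplacian of the standard measure `μ`, and `Δ_μ u = f`. -/
def IsLaplacian (u f : Plane → ℝ) : Prop :=
  DomEnergy u ∧ ContinuousOn f gasket ∧
    ∀ v : Plane → ℝ, DomEnergyZero v →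
      energy u v = -∫ x in gasket, f x * v x ∂standardMeasure

/-! The gasket is the attractor of the six maps, and the standard measure is the self-similar
probability measure with equal weights. -/

theorem exists_norm_le : ∃ C : ℝ, ∀ i : Fin 6, ‖(2 / 3 : ℝ) • center i‖ ≤ C := by
  obtain ⟨C, hC⟩ := (Set.finite_range fun i : Fin 6 => ‖(2 / 3 : ℝ) • center i‖).bddAbove
  exact ⟨C, fun i => hC ⟨i, rfl⟩⟩

theorem norm_term_le {C : ℝ} (hC : ∀ i : Fin 6, ‖(2 / 3 : ℝ) • center i‖ ≤ C) (n : ℕ)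
    (w : ℕ → Fin 6) :
    ‖(1 / 3 : ℝ) ^ n • ((2 / 3 : ℝ) • center (w n))‖ ≤ (1 / 3 : ℝ) ^ n * C := by
  rw [norm_smul, norm_pow]
  have h : ‖(1 / 3 : ℝ)‖ = 1 / 3 := by norm_num
  rw [h]
  exact mul_le_mul_of_nonneg_left (hC _) (by positivity)

theorem summable_bound (C : ℝ) : Summable fun n : ℕ => (1 / 3 : ℝ) ^ n * C :=
  (summable_geometric_of_lt_one (by norm_num) (by norm_num)).mul_right C

theorem summable_address (w : ℕ → Fin 6) :
    Summable fun n : ℕ => (1 / 3 : ℝ) ^ n • ((2 / 3 : ℝ) • center (w n)) := by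
  obtain ⟨C, hC⟩ := exists_norm_le
  exact (summable_bound C).of_norm_bounded fun n => norm_term_le hC n w

theorem continuous_address : Continuous address := by
  obtain ⟨C, hC⟩ := exists_norm_le
  refine continuous_tsum (fun n => ?_) (summable_bound C) (fun n w => norm_term_le hC n w)
  have h : Continuous fun i : Fin 6 => (1 / 3 : ℝ) ^ n • ((2 / 3 : ℝ) • center i) :=
    continuous_of_discreteTopology
  exact h.comp (continuous_apply n)

theorem address_eq (w : ℕ → Fin 6) : address w = F (w 0) (address fun n => w (n + 1)) := by
  have h := (summable_address w).tsum_eq_zero_add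
  rw [address, h, F, address, ← tsum_const_smul'']
  simp only [pow_zero, one_smul, pow_succ', mul_smul]
  rw [add_comm]

/-- The word that starts with `i` and goes on as `w`. -/
def cons (i : Fin 6) (w : ℕ → Fin 6) : ℕ → Fin 6
  | 0 => i
  | n + 1 => w n

theorem address_cons (i : Fin 6) (w : ℕ → Fin 6) : address (cons i w) = F i (address w) :=
  address_eq (cons i w)

theorem isCompact_gasket : IsCompact gasket := isCompact_range continuous_address

theorem gasket_nonempty : gasket.Nonempty := Set.range_nonempty address

theorem gasket_eq_iUnion : gasket = ⋃ i : Fin 6, F i '' gasket := by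
  ext x
  simp only [Set.mem_iUnion, Set.mem_image]
  constructor
  · rintro ⟨w, rfl⟩
    exact ⟨w 0, _, ⟨_, rfl⟩, (address_eq w).symm⟩
  · rintro ⟨i, _, ⟨w, rfl⟩, rfl⟩
    exact ⟨cons i w, address_cons i w⟩

/-- The uniform Bernoulli measure on the infinite words. -/
abbrev bernoulli : Measure (ℕ → Fin 6) :=
  Measure.infinitePi fun _ : ℕ => (PMF.uniformOfFintype (Fin 6)).toMeasure

theorem measurable_cons (i : Fin 6) : Measurable (cons i) := by
  refine measurable_pi_lambda _ fun n => ?_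
  cases n with
  | zero => exact measurable_const
  | succ n => exact measurable_pi_apply n

theorem uniform_apply (s : Set (Fin 6)) :
    (PMF.uniformOfFintype (Fin 6)).toMeasure s =
      (6 : ENNReal)⁻¹ * ∑ i : Fin 6, s.indicator 1 i := by
  rw [PMF.toMeasure_apply_fintype, Finset.mul_sum]
  refine Finset.sum_congr rfl fun i _ => ?_
  by_cases h : i ∈ s <;> simp [h]

theorem bernoulli_eq : (6 : ENNReal)⁻¹ • ∑ i : Fin 6, bernoulli.map (cons i) = bernoulli := by
  classical
  refine Measure.eq_infinitePi _ fun s t ht => ?_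
  obtain ⟨N, hN⟩ : ∃ N : ℕ, s ⊆ Finset.range (N + 1) :=
    ⟨s.sup id, fun n hn => Finset.mem_range.2 (Nat.lt_succ_of_le (Finset.le_sup (f := id) hn))⟩
  let t' : ℕ → Set (Fin 6) := fun n => if n ∈ s then t n else Set.univ
  have hpi : Set.pi (s : Set ℕ) t = Set.pi (Finset.range (N + 1) : Set ℕ) t' := by
    ext w
    simp only [Set.mem_pi, Finset.mem_coe, t']
    constructor
    · intro h n _
      by_cases hn : n ∈ s
      · simpa [hn] using h n hn
      · simp [hn]
    · intro h n hn
      simpa [hn] using h n (hN hn)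
  have hmt : ∀ n, MeasurableSet (t' n) := fun n => MeasurableSet.of_discrete
  have hms : MeasurableSet (Set.pi (Finset.range (N + 1) : Set ℕ) t') :=
    MeasurableSet.pi (Finset.countable_toSet _) fun n _ => hmt n
  have hprod : ∏ n ∈ s, (PMF.uniformOfFintype (Fin 6)).toMeasure (t n) =
      ∏ n ∈ Finset.range (N + 1), (PMF.uniformOfFintype (Fin 6)).toMeasure (t' n) := by
    rw [← Finset.prod_subset hN]
    · exact Finset.prod_congr rfl fun n hn => by simp [t', hn]
    · intro n _ hn
      simp [t', hn]
  have hpre : ∀ i : Fin 6, bernoulli (cons i ⁻¹' Set.pi (Finset.range (N + 1) : Set ℕ) t') =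
      (t' 0).indicator 1 i *
        ∏ n ∈ Finset.range N, (PMF.uniformOfFintype (Fin 6)).toMeasure (t' (n + 1)) := by
    intro i
    by_cases hi : i ∈ t' 0
    · have : cons i ⁻¹' Set.pi (Finset.range (N + 1) : Set ℕ) t' =
          Set.pi (Finset.range N : Set ℕ) fun n => t' (n + 1) := by
        ext w
        simp only [Set.mem_preimage, Set.mem_pi, Finset.mem_coe, Finset.mem_range]
        constructor
        · exact fun h n hn => h (n + 1) (by omega)
        · intro h n hn
          cases n with
          | zero => exact hi
          | succ n => exact h n (by omega)
      rw [this, Measure.infinitePi_pi _ fun n _ => hmt (n + 1)]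
      simp [hi]
    · have : cons i ⁻¹' Set.pi (Finset.range (N + 1) : Set ℕ) t' = ∅ := by
        ext w
        simp only [Set.mem_preimage, Set.mem_pi, Finset.mem_coe, Finset.mem_range,
          Set.mem_empty_iff_false, iff_false]
        exact fun h => hi (h 0 (by omega))
      rw [this]
      simp [hi]
  rw [hpi, hprod, Finset.prod_range_succ', Measure.smul_apply, Measure.finsetSum_apply,
    uniform_apply (t' 0), smul_eq_mul]
  simp_rw [Measure.map_apply (measurable_cons _) hms, hpre]
  rw [← Finset.sum_mul]
  ring

instance : IsProbabilityMeasure standardMeasure :=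
  Measure.isProbabilityMeasure_map continuous_address.measurable.aemeasurable

theorem standardMeasure_gasket : standardMeasure gasket = 1 := by
  rw [standardMeasure, Measure.map_apply continuous_address.measurable
    isCompact_gasket.measurableSet, gasket, Set.preimage_range]
  exact measure_univ

theorem continuous_F (i : Fin 6) : Continuous (F i) := by
  unfold F
  fun_prop

theorem standardMeasure_apply {A : Set Plane} (hA : MeasurableSet A) :
    standardMeasure A = ∑ i : Fin 6, (6 : ENNReal)⁻¹ * standardMeasure (F i ⁻¹' A) := by
  have h : standardMeasure A = (bernoulli.map address) A := rfl
  rw [h, ← bernoulli_eq, Measure.map_apply continuous_address.measurable hA,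
    Measure.smul_apply, Measure.finsetSum_apply, smul_eq_mul, Finset.mul_sum]
  refine Finset.sum_congr rfl fun i _ => ?_
  rw [Measure.map_apply (measurable_cons i) (continuous_address.measurable hA), standardMeasure,
    Measure.map_apply continuous_address.measurable ((continuous_F i).measurable hA)]
  congr 2
  ext w
  simp only [Set.mem_preimage, address_cons]

end SG3

end

noncomputable section

namespace SG3

/-! The weak equation is tested with tents. For a vertex `p ∈ V m` outside `V 0`, `tent m p` is
harmonic on every `m`-cell, equal to 1 at `p` and 0 at the other vertices of level `m`. Refining a
harmonic spline multiplies its energy against any function `u` by `r = 7/15` at each level, so the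
renormalized energies of `u` and the tent are constant from level `m` on, and `E(u, tent) = -r^(-m)
deg_m(p) Δ_m u(p)` (`energy_spline`, `graphEnergy_single`).

The mean of a harmonic function over a cell is the mean of its three boundary values. Each `m`-cell
at `p` therefore adds `6^(-m)/3` to the integral of the tent and 2 to the degree of `p`, whence
`deg_m(p) = 6^(m+1) ∫ tent` (`deg_eq_integral_tent`). Dividing, `6 (6/r)^m Δ_m u(p) = ∫ f·tent / ∫
tent` with `6/r = 90/7` (`graphLaplacian_eq`). The right side is a weighted mean of `f` over a set
of diameter `O(3^(-m))` around `p = x_m`, so continuity of `f` at `x` gives the limit.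

Harmonic functions are built on the space of words, where their continuity follows from geometric
contraction of oscillation. They descend to the gasket because, once two words with the same address
differ in a letter, the tails after it are addresses of vertices. -/

/-! ### Barycentric coordinates -/

/-- Barycentric coordinates with respect to the triangle `q 0, q 1, q 2`. -/
def bary (x : Plane) : Fin 3 → ℝ :=
  ![2 * x 1 / Real.sqrt 3, 1 - x 0 - x 1 / Real.sqrt 3, x 0 - x 1 / Real.sqrt 3]

/-- The barycentric coordinates of `2 • center i`. -/
def offset : Fin 6 → Fin 3 → ℕ :=
  ![![2, 0, 0], ![0, 2, 0], ![0, 0, 2], ![0, 1, 1], ![1, 0, 1], ![1, 1, 0]]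

/-- The index of the contraction that fixes `q k`. -/
def corner : Fin 3 → Fin 6 := ![0, 1, 2]

theorem bary_injective : Function.Injective bary := by
  intro x y h
  have h3 : Real.sqrt 3 ≠ 0 := by positivity
  have h0 := congrFun h 0
  have h2 := congrFun h 2
  simp only [bary, Matrix.cons_val] at h0 h2
  field_simp at h0
  have h1 : x 1 = y 1 := by linarith
  rw [h1] at h2
  ext i
  fin_cases i
  · simpa using h2
  · exact h1

theorem bary_sum (x : Plane) : bary x 0 + bary x 1 + bary x 2 = 1 := by
  simp only [bary, Matrix.cons_val]
  ring

theorem bary_q (k l : Fin 3) : bary (q k) l = if k = l then 1 else 0 := by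
  have h3 : Real.sqrt 3 ≠ 0 := by positivity
  fin_cases k <;> fin_cases l <;> simp [bary, q] <;> field_simp <;> norm_num

theorem bary_F (i : Fin 6) (x : Plane) (l : Fin 3) :
    bary (F i x) l = (bary x l + offset i l) / 3 := by
  have h3 : Real.sqrt 3 ≠ 0 := by positivity
  fin_cases i <;> fin_cases l <;>
    simp [bary, F, center, q, offset, midpoint_eq_smul_add] <;> field_simp <;> ring

theorem continuous_bary (l : Fin 3) : Continuous fun x => bary x l := by
  fin_cases l <;> simp only [bary] <;> simp <;> fun_prop

/-- Compactness gives some lower bound; since offsets are nonnegative, each application of the maps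
`F i` improves it by a factor `1/3`. -/
theorem bary_nonneg {x : Plane} (hx : x ∈ gasket) (l : Fin 3) : 0 ≤ bary x l := by
  obtain ⟨C, hC⟩ := (isCompact_gasket.image (continuous_bary l)).bddBelow
  have key : ∀ n : ℕ, ∀ w, (1 / 3 : ℝ) ^ n * min C 0 ≤ bary (address w) l := by
    intro n
    induction n with
    | zero =>
      intro w
      have := hC ⟨address w, ⟨w, rfl⟩, rfl⟩
      simpa using Or.inl this
    | succ n ih =>
      intro w
      rw [address_eq, bary_F, pow_succ]
      have h1 := ih fun n => w (n + 1)
      have h2 : (0 : ℝ) ≤ offset (w 0) l := Nat.cast_nonneg _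
      linarith
  obtain ⟨w, rfl⟩ := hx
  have ht : Tendsto (fun n : ℕ => (1 / 3 : ℝ) ^ n * min C 0) atTop (𝓝 (0 * min C 0)) :=
    (tendsto_pow_atTop_nhds_zero_of_lt_one (by norm_num) (by norm_num)).mul_const _
  rw [zero_mul] at ht
  exact le_of_tendsto' ht fun n => key n w

theorem F_injective (i : Fin 6) : Function.Injective (F i) := by
  intro x y h
  apply bary_injective
  funext l
  have := congrArg (fun z => bary z l) h
  simp only [bary_F] at this
  linarith

theorem dist_F (i : Fin 6) (x y : Plane) : dist (F i x) (F i y) = 1 / 3 * dist x y := by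
  rw [F, F, dist_add_right, dist_smul₀]
  norm_num

theorem q_injective : Function.Injective q := by
  intro k l h
  have := congrArg (fun z => bary z l) h
  simp only [bary_q] at this
  by_contra hkl
  simp [hkl] at this

theorem eq_q_of_one_le_bary {x : Plane} (hx : x ∈ gasket) {k : Fin 3} (h : 1 ≤ bary x k) :
    x = q k := by
  apply bary_injective
  have hs := bary_sum x
  have h0 := bary_nonneg hx 0
  have h1 := bary_nonneg hx 1
  have h2 := bary_nonneg hx 2
  funext l
  rw [bary_q]
  fin_cases k <;> fin_cases l <;> simp at h ⊢ <;> linarith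

/-- Reduces coincidences between vertices of 1-cells to identities of natural numbers, which
`decide` can settle. -/
theorem F_q_eq_iff (i j : Fin 6) (k l : Fin 3) :
    F i (q k) = F j (q l) ↔
      ∀ n, offset i n + (if k = n then 1 else 0) = offset j n + if l = n then 1 else 0 := by
  rw [← bary_injective.eq_iff, funext_iff]
  refine forall_congr' fun n => ?_
  rw [bary_F, bary_F, bary_q, bary_q, div_left_inj' (by norm_num), add_comm, add_comm (ite _ _ _)]
  exact_mod_cast Iff.rfl

theorem F_corner_q (k : Fin 3) : F (corner k) (q k) = q k := by
  apply bary_injective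
  funext l
  rw [bary_F, bary_q]
  fin_cases k <;> fin_cases l <;> simp [offset, corner] <;> norm_num

/-- Two different cells meet at most in one point, which is a vertex of both. -/
theorem exists_vertex_of_F_eq {i j : Fin 6} (hij : i ≠ j) :
    ∃ k l : Fin 3, ∀ x ∈ gasket, ∀ y ∈ gasket, F i x = F j y → x = q k ∧ y = q l := by
  -- Distinct offsets have the same sum 2, so each exceeds the other in some coordinate. Comparing
  -- that coordinate on both sides of `F i x = F j y` pushes a barycentric coordinate of `x` or `y`
  -- up to 1, the value at a vertex.
  have key : ∀ i j : Fin 6, i ≠ j → ∃ k l : Fin 3,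
      offset i k + 1 ≤ offset j k ∧ offset j l + 1 ≤ offset i l := by decide
  obtain ⟨k, l, h1, h2⟩ := key i j hij
  refine ⟨k, l, fun x hx y hy h => ⟨eq_q_of_one_le_bary hx ?_, eq_q_of_one_le_bary hy ?_⟩⟩
  · have h3 := congrArg (fun z => bary z k) h
    simp only [bary_F] at h3
    have h4 := bary_nonneg hy k
    have h5 : (offset i k : ℝ) + 1 ≤ offset j k := by exact_mod_cast h1
    linarith
  · have h3 := congrArg (fun z => bary z l) h
    simp only [bary_F] at h3
    have h4 := bary_nonneg hx l
    have h5 : (offset j l : ℝ) + 1 ≤ offset i l := by exact_mod_cast h2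
    linarith

theorem F_mem_gasket (i : Fin 6) {x : Plane} (hx : x ∈ gasket) : F i x ∈ gasket := by
  obtain ⟨w, rfl⟩ := hx
  exact ⟨cons i w, address_cons i w⟩

theorem eq_q_of_F_corner_eq {k : Fin 3} {i : Fin 6} {x : Plane} (hx : x ∈ gasket)
    (h : F i x = q k) : i = corner k ∧ x = q k := by
  have h3 := congrArg (fun z => bary z k) h
  simp only [bary_F, bary_q, if_true] at h3
  have hle : bary x k ≤ 1 := by
    have hs := bary_sum x
    have h0 := bary_nonneg hx 0
    have h1 := bary_nonneg hx 1
    have h2 := bary_nonneg hx 2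
    fin_cases k <;> simp <;> linarith
  have h2 : 2 ≤ offset i k := by
    have : (2 : ℝ) ≤ offset i k := by linarith
    exact_mod_cast this
  have hi : ∀ i k, 2 ≤ offset i k → i = corner k := by decide
  obtain rfl := hi i k h2
  exact ⟨rfl, F_injective _ (h.trans (F_corner_q k).symm)⟩

theorem q_mem_gasket (k : Fin 3) : q k ∈ gasket := by
  refine ⟨fun _ => corner k, ?_⟩
  set x := address fun _ => corner k with hx
  have h : x = F (corner k) x := address_eq _
  have h' := F_corner_q k
  apply bary_injective
  funext l
  have e1 := congrArg (fun z => bary z l) h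
  have e2 := congrArg (fun z => bary z l) h'
  simp only [bary_F] at e1 e2
  linarith

/-- The shift on infinite words. -/
def shift (w : ℕ → Fin 6) : ℕ → Fin 6 := fun n => w (n + 1)

theorem continuous_shift : Continuous shift := by
  unfold shift
  fun_prop

theorem address_eq_shift (w : ℕ → Fin 6) : address w = F (w 0) (address (shift w)) :=
  address_eq w

theorem address_mem_gasket (w : ℕ → Fin 6) : address w ∈ gasket := ⟨w, rfl⟩

theorem address_eq_q {w : ℕ → Fin 6} {k : Fin 3} (h : address w = q k) :
    w 0 = corner k ∧ address (shift w) = q k :=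
  eq_q_of_F_corner_eq (address_mem_gasket _) ((address_eq_shift w).symm.trans h)

/-- Words with the same address that start differently end in the address of a vertex. -/
theorem exists_address_shift_eq_q {w w' : ℕ → Fin 6} (h : address w = address w')
    (h0 : w 0 ≠ w' 0) : ∃ k l : Fin 3, address (shift w) = q k ∧ address (shift w') = q l ∧
      F (w 0) (q k) = F (w' 0) (q l) := by
  rw [address_eq_shift w, address_eq_shift w'] at h
  obtain ⟨k, l, hkl⟩ := exists_vertex_of_F_eq h0
  obtain ⟨h1, h2⟩ := hkl _ (address_mem_gasket _) _ (address_mem_gasket _) h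
  exact ⟨k, l, h1, h2, by rw [← h1, ← h2, h]⟩

theorem address_shift_eq {w w' : ℕ → Fin 6} (h : address w = address w')
    (h0 : w 0 = w' 0) : address (shift w) = address (shift w') := by
  rw [address_eq_shift w, address_eq_shift w', h0] at h
  exact F_injective _ h

/-! ### Vertices and the graph energy -/

theorem mem_V_zero {x : Plane} : x ∈ V 0 ↔ ∃ k, q k = x := by simp [V]

theorem mem_V_succ {m : ℕ} {x : Plane} : x ∈ V (m + 1) ↔ ∃ i, ∃ y ∈ V m, F i y = x := by
  simp [V]

theorem V_subset_gasket {m : ℕ} {x : Plane} (hx : x ∈ V m) : x ∈ gasket := by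
  induction m generalizing x with
  | zero =>
    obtain ⟨k, rfl⟩ := mem_V_zero.1 hx
    exact q_mem_gasket k
  | succ m ih =>
    obtain ⟨i, y, hy, rfl⟩ := mem_V_succ.1 hx
    exact F_mem_gasket i (ih hy)

theorem q_mem_V (m : ℕ) (k : Fin 3) : q k ∈ V m := by
  induction m with
  | zero => exact mem_V_zero.2 ⟨k, rfl⟩
  | succ m ih => exact mem_V_succ.2 ⟨corner k, q k, ih, F_corner_q k⟩

theorem Adj.mem {m : ℕ} {x y : Plane} (h : Adj m x y) : x ∈ V m ∧ y ∈ V m := by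
  induction m generalizing x y with
  | zero => exact ⟨h.1, h.2.1⟩
  | succ m ih =>
    obtain ⟨i, x', y', h', rfl, rfl⟩ := h
    exact ⟨mem_V_succ.2 ⟨i, x', (ih h').1, rfl⟩, mem_V_succ.2 ⟨i, y', (ih h').2, rfl⟩⟩

theorem Adj.ne {m : ℕ} {x y : Plane} (h : Adj m x y) : x ≠ y := by
  induction m generalizing x y with
  | zero => exact h.2.2
  | succ m ih =>
    obtain ⟨i, x', y', h', rfl, rfl⟩ := h
    exact fun he => ih h' (F_injective i he)

theorem Adj.symm {m : ℕ} {x y : Plane} (h : Adj m x y) : Adj m y x := by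
  induction m generalizing x y with
  | zero => exact ⟨h.2.1, h.1, h.2.2.symm⟩
  | succ m ih =>
    obtain ⟨i, x', y', h', rfl, rfl⟩ := h
    exact ⟨i, y', x', ih h', rfl, rfl⟩

theorem exists_adj {m : ℕ} {x : Plane} (hx : x ∈ V m) : ∃ y, Adj m x y := by
  induction m generalizing x with
  | zero =>
    obtain ⟨k, rfl⟩ := mem_V_zero.1 hx
    refine ⟨q (k + 1), hx, mem_V_zero.2 ⟨_, rfl⟩, fun h => ?_⟩
    have hk : ∀ k : Fin 3, k ≠ k + 1 := by decide
    exact hk k (q_injective h)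
  | succ m ih =>
    obtain ⟨i, x', hx', rfl⟩ := mem_V_succ.1 hx
    obtain ⟨y, hy⟩ := ih hx'
    exact ⟨F i y, i, x', y, hy, rfl, rfl⟩

theorem mem_neighbors {m : ℕ} {x y : Plane} : y ∈ neighbors m x ↔ Adj m x y := by
  classical
  rw [neighbors, Finset.mem_filter]
  exact ⟨fun h => h.2, fun h => ⟨h.mem.2, h⟩⟩

theorem deg_pos {m : ℕ} {x : Plane} (hx : x ∈ V m) : 0 < deg m x := by
  obtain ⟨y, hy⟩ := exists_adj hx
  exact Finset.card_pos.2 ⟨y, mem_neighbors.2 hy⟩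

open Classical in
/-- The ordered pairs of adjacent vertices of level `m`. -/
def arcs (m : ℕ) : Finset (Plane × Plane) := (V m ×ˢ V m).filter fun e => Adj m e.1 e.2

theorem mem_arcs {m : ℕ} {e : Plane × Plane} : e ∈ arcs m ↔ Adj m e.1 e.2 := by
  classical
  rw [arcs, Finset.mem_filter, Finset.mem_product]
  exact ⟨fun h => h.2, fun h => ⟨h.mem, h⟩⟩

theorem sum_neighbors (m : ℕ) (φ : Plane → Plane → ℝ) :
    ∑ x ∈ V m, ∑ y ∈ neighbors m x, φ x y = ∑ e ∈ arcs m, φ e.1 e.2 := by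
  classical
  rw [arcs, Finset.sum_filter, Finset.sum_product]
  refine Finset.sum_congr rfl fun x _ => ?_
  rw [neighbors, Finset.sum_filter]

theorem graphEnergy_eq_sum_arcs (m : ℕ) (u v : Plane → ℝ) :
    graphEnergy m u v = 1 / 2 * ∑ e ∈ arcs m, (u e.1 - u e.2) * (v e.1 - v e.2) := by
  rw [graphEnergy, sum_neighbors m fun x y => (u x - u y) * (v x - v y)]

theorem graphEnergy_congr {m : ℕ} {u u' v v' : Plane → ℝ} (hu : ∀ x ∈ V m, u x = u' x)
    (hv : ∀ x ∈ V m, v x = v' x) : graphEnergy m u v = graphEnergy m u' v' := by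
  rw [graphEnergy_eq_sum_arcs, graphEnergy_eq_sum_arcs]
  congr 1
  refine Finset.sum_congr rfl fun e he => ?_
  obtain ⟨h1, h2⟩ := (mem_arcs.1 he).mem
  rw [hu _ h1, hu _ h2, hv _ h1, hv _ h2]

theorem graphEnergy_self_nonneg (m : ℕ) (u : Plane → ℝ) : 0 ≤ graphEnergy m u u := by
  rw [graphEnergy_eq_sum_arcs]
  exact mul_nonneg (by norm_num) (Finset.sum_nonneg fun e _ => mul_self_nonneg _)

theorem graphEnergy_sub_self (m : ℕ) (u v : Plane → ℝ) :
    graphEnergy m (fun x => u x - v x) (fun x => u x - v x) =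
      graphEnergy m u u - 2 * graphEnergy m u v + graphEnergy m v v := by
  simp only [graphEnergy_eq_sum_arcs, Finset.mul_sum, ← Finset.sum_sub_distrib,
    ← Finset.sum_add_distrib]
  exact Finset.sum_congr rfl fun e _ => by ring

open Classical in
theorem arcs_succ (m : ℕ) :
    arcs (m + 1) = Finset.univ.biUnion fun i => (arcs m).image (Prod.map (F i) (F i)) := by
  ext ⟨x, y⟩
  simp only [mem_arcs, Finset.mem_biUnion, Finset.mem_univ, true_and, Finset.mem_image,
    Prod.exists, Prod.map_apply, Prod.mk.injEq]
  rfl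

/-- No edge is counted twice: different cells share at most one point, while an edge has two
distinct ends. -/
theorem graphEnergy_succ (m : ℕ) (u v : Plane → ℝ) :
    graphEnergy (m + 1) u v = ∑ i, graphEnergy m (u ∘ F i) (v ∘ F i) := by
  classical
  simp only [graphEnergy_eq_sum_arcs]
  rw [← Finset.mul_sum, arcs_succ, Finset.sum_biUnion]
  · congr 1
    refine Finset.sum_congr rfl fun i _ => ?_
    rw [Finset.sum_image fun a _ b _ h => (F_injective i).prodMap (F_injective i) h]
    rfl
  · intro i _ j _ hij
    rw [Function.onFun, Finset.disjoint_left]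
    intro e hi hj
    obtain ⟨a, ha, rfl⟩ := Finset.mem_image.1 hi
    obtain ⟨b, hb, hab⟩ := Finset.mem_image.1 hj
    obtain ⟨k, l, hkl⟩ := exists_vertex_of_F_eq hij
    rw [mem_arcs] at ha hb
    have h1 := hkl _ (V_subset_gasket ha.mem.1) _ (V_subset_gasket hb.mem.1)
      (congrArg Prod.fst hab).symm
    have h2 := hkl _ (V_subset_gasket ha.mem.2) _ (V_subset_gasket hb.mem.2)
      (congrArg Prod.snd hab).symm
    exact ha.ne (h1.1.trans h2.1.symm)

theorem graphEnergy_zero (u v : Plane → ℝ) :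
    graphEnergy 0 u v = (u (q 0) - u (q 1)) * (v (q 0) - v (q 1)) +
      (u (q 0) - u (q 2)) * (v (q 0) - v (q 2)) + (u (q 1) - u (q 2)) * (v (q 1) - v (q 2)) := by
  classical
  have h : ∀ x ∈ V 0, ∑ y ∈ neighbors 0 x, (u x - u y) * (v x - v y) =
      ∑ y ∈ V 0, (u x - u y) * (v x - v y) := by
    intro x hx
    rw [neighbors, Finset.sum_filter]
    refine Finset.sum_congr rfl fun y hy => ?_
    by_cases hxy : x = y
    · simp [hxy]
    · exact if_pos ⟨hx, hy, hxy⟩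
  rw [graphEnergy, Finset.sum_congr rfl h]
  simp only [V, Finset.sum_image fun a _ b _ h => q_injective h, Fin.sum_univ_three]
  ring

/-- The energy of level `m` tested with the indicator function of a vertex. -/
theorem graphEnergy_single {m : ℕ} (u : Plane → ℝ) {v : Plane → ℝ} {p : Plane} (hp : p ∈ V m)
    (hv : v p = 1) (hv' : ∀ x ∈ V m, x ≠ p → v x = 0) :
    graphEnergy m u v = ∑ y ∈ neighbors m p, (u p - u y) := by
  classical
  have h1 : ∀ φ : Plane → ℝ, ∑ x ∈ V m, φ x * v x = φ p := by
    intro φ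
    rw [Finset.sum_eq_single_of_mem p hp fun x hx hxp => by rw [hv' x hx hxp, mul_zero], hv,
      mul_one]
  have e : ∀ φ : Plane → Plane → ℝ, ∑ e ∈ arcs m, φ e.1 e.2 * v e.1 =
      ∑ y ∈ neighbors m p, φ p y := by
    intro φ
    rw [← sum_neighbors m fun x y => φ x y * v x]
    simp only [← Finset.sum_mul]
    exact h1 fun x => ∑ y ∈ neighbors m x, φ x y
  have hswap : ∑ e ∈ arcs m, (u e.2 - u e.1) * v e.2 = ∑ e ∈ arcs m, (u e.1 - u e.2) * v e.1 :=
    Finset.sum_nbij' Prod.swap Prod.swap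
      (fun e he => mem_arcs.2 (mem_arcs.1 he).symm) (fun e he => mem_arcs.2 (mem_arcs.1 he).symm)
      (fun _ _ => rfl) (fun _ _ => rfl) (fun _ _ => rfl)
  have hsum : ∑ e ∈ arcs m, (u e.1 - u e.2) * (v e.1 - v e.2) =
      ∑ e ∈ arcs m, (u e.1 - u e.2) * v e.1 + ∑ e ∈ arcs m, (u e.2 - u e.1) * v e.2 := by
    rw [← Finset.sum_add_distrib]
    exact Finset.sum_congr rfl fun e _ => by ring
  rw [graphEnergy_eq_sum_arcs, hsum, hswap, e fun x y => u x - u y]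
  ring

/-! ### Harmonic extension -/

/-- Fifteen times the coefficients of the harmonic extension: `harmonicCoeff i k j / 15` is the
value at `F i (q k)` of the harmonic function with boundary values `1` at `q j` and `0` at the
other vertices. -/
def harmonicCoeff : Fin 6 → Fin 3 → Fin 3 → ℕ :=
  ![![![15, 0, 0], ![8, 4, 3], ![8, 3, 4]],
    ![![4, 8, 3], ![0, 15, 0], ![3, 8, 4]],
    ![![4, 3, 8], ![3, 4, 8], ![0, 0, 15]],
    ![![5, 5, 5], ![3, 8, 4], ![3, 4, 8]],
    ![![8, 3, 4], ![5, 5, 5], ![4, 3, 8]],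
    ![![8, 4, 3], ![4, 8, 3], ![5, 5, 5]]]

/-- The values at the vertices of the cell `i` of the harmonic function with boundary
values `a`. -/
def harmonicStep (i : Fin 6) (a : Fin 3 → ℝ) (k : Fin 3) : ℝ :=
  (harmonicCoeff i k 0 * a 0 + harmonicCoeff i k 1 * a 1 + harmonicCoeff i k 2 * a 2) / 15

/-- Makes the extension single-valued at the points where 1-cells meet. -/
theorem harmonicStep_congr {i j : Fin 6} {k l : Fin 3} (h : F i (q k) = F j (q l))
    (a : Fin 3 → ℝ) : harmonicStep i a k = harmonicStep j a l := by
  rw [F_q_eq_iff] at h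
  have key : ∀ i j k l,
      (∀ n, offset i n + (if k = n then 1 else 0) = offset j n + if l = n then 1 else 0) →
        harmonicCoeff i k = harmonicCoeff j l := by decide
  rw [harmonicStep, harmonicStep, key i j k l h]

theorem harmonicStep_corner (a : Fin 3 → ℝ) (k : Fin 3) : harmonicStep (corner k) a k = a k := by
  fin_cases k <;> simp [harmonicStep, harmonicCoeff, corner]

theorem harmonicStep_mem_Icc {a : Fin 3 → ℝ} {s t : ℝ} (h : ∀ k, a k ∈ Set.Icc s t) (i : Fin 6)
    (k : Fin 3) : harmonicStep i a k ∈ Set.Icc s t := by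
  have hc : ∀ i k, harmonicCoeff i k 0 + harmonicCoeff i k 1 + harmonicCoeff i k 2 = 15 := by
    decide
  have hc' : (harmonicCoeff i k 0 + harmonicCoeff i k 1 + harmonicCoeff i k 2 : ℝ) = 15 := by
    exact_mod_cast hc i k
  have hl (n : Fin 3) : harmonicCoeff i k n * s ≤ harmonicCoeff i k n * a n :=
    mul_le_mul_of_nonneg_left (h n).1 (Nat.cast_nonneg _)
  have hu (n : Fin 3) : harmonicCoeff i k n * a n ≤ harmonicCoeff i k n * t :=
    mul_le_mul_of_nonneg_left (h n).2 (Nat.cast_nonneg _)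
  have e (c : ℝ) : harmonicCoeff i k 0 * c + harmonicCoeff i k 1 * c + harmonicCoeff i k 2 * c =
      15 * c := by rw [← hc']; ring
  have := e s
  have := e t
  have := hl 0
  have := hl 1
  have := hl 2
  have := hu 0
  have := hu 1
  have := hu 2
  constructor <;> rw [harmonicStep] <;> linarith

/-- The boundary values `a` have oscillation at most `M`. -/
def OscLE (a : Fin 3 → ℝ) (M : ℝ) : Prop := ∀ k l, a k - a l ≤ M

theorem exists_oscLE (a : Fin 3 → ℝ) : ∃ M, 0 ≤ M ∧ OscLE a M := by
  obtain ⟨C, hC⟩ := (Set.finite_range fun p : Fin 3 × Fin 3 => a p.1 - a p.2).bddAbove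
  have h : OscLE a C := fun k l => hC ⟨(k, l), rfl⟩
  exact ⟨C, by simpa using h 0 0, h⟩

/-- Two rows of `harmonicCoeff i` have equal sums and differ by a vector with positive part at most
7, attained in the corner cells (`15 - 8`). Here `7/15` is only a contraction rate; that it equals
the energy factor plays no role. -/
theorem OscLE.harmonicStep {a : Fin 3 → ℝ} {M : ℝ} (h : OscLE a M) (i : Fin 6) :
    OscLE (harmonicStep i a) (7 / 15 * M) := by
  have h01 := h 0 1
  have h10 := h 1 0
  have h02 := h 0 2
  have h20 := h 2 0
  have h12 := h 1 2
  have h21 := h 2 1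
  intro k l
  fin_cases i <;> fin_cases k <;> fin_cases l <;>
    simp [SG3.harmonicStep, harmonicCoeff] <;> linarith

theorem abs_harmonicStep_sub_le {a : Fin 3 → ℝ} {M : ℝ} (h : OscLE a M) (i : Fin 6)
    (k l : Fin 3) : |harmonicStep i a k - a l| ≤ M := by
  have := harmonicStep_mem_Icc (a := a) (s := a l - M) (t := a l + M)
    (fun n => ⟨by linarith [h l n], by linarith [h n l]⟩) i k
  rw [abs_le]
  constructor <;> linarith [this.1, this.2]

/-- The value at the vertex `0` of the `n`-cell with address `w` of the harmonic function with
boundary values `a`. -/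
def harmonicApprox : ℕ → (Fin 3 → ℝ) → (ℕ → Fin 6) → ℝ
  | 0, a, _ => a 0
  | n + 1, a, w => harmonicApprox n (harmonicStep (w 0) a) (shift w)

theorem continuous_of_cases {G : Fin 6 → (ℕ → Fin 6) → ℝ} (hG : ∀ i, Continuous (G i)) :
    Continuous fun w : ℕ → Fin 6 => G (w 0) (shift w) := by
  have h : Continuous fun p : Fin 6 × (ℕ → Fin 6) => G p.1 p.2 :=
    continuous_prod_of_discrete_left.2 hG
  exact h.comp ((continuous_apply 0).prodMk continuous_shift)

theorem continuous_harmonicApprox (n : ℕ) (a : Fin 3 → ℝ) : Continuous (harmonicApprox n a) := by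
  induction n generalizing a with
  | zero => exact continuous_const
  | succ n ih => exact continuous_of_cases fun i => ih (harmonicStep i a)

theorem harmonicApprox_mem_Icc {a : Fin 3 → ℝ} {s t : ℝ} (h : ∀ k, a k ∈ Set.Icc s t) (n : ℕ)
    (w : ℕ → Fin 6) : harmonicApprox n a w ∈ Set.Icc s t := by
  induction n generalizing a w with
  | zero => exact h 0
  | succ n ih => exact ih (harmonicStep_mem_Icc h _) _

theorem dist_harmonicApprox_succ_le {a : Fin 3 → ℝ} {M : ℝ} (h : OscLE a M) (n : ℕ)
    (w : ℕ → Fin 6) :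
    dist (harmonicApprox n a w) (harmonicApprox (n + 1) a w) ≤ M * (7 / 15) ^ n := by
  induction n generalizing a w M with
  | zero =>
    rw [dist_comm, Real.dist_eq, pow_zero, mul_one]
    exact abs_harmonicStep_sub_le h _ _ _
  | succ n ih =>
    refine (ih (h.harmonicStep (w 0)) (shift w)).trans_eq ?_
    ring

/-- The harmonic function with boundary values `a`, on the space of words. -/
def harmonic (a : Fin 3 → ℝ) (w : ℕ → Fin 6) : ℝ :=
  limUnder atTop fun n => harmonicApprox n a w

theorem tendsto_harmonicApprox (a : Fin 3 → ℝ) (w : ℕ → Fin 6) :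
    Tendsto (fun n => harmonicApprox n a w) atTop (𝓝 (harmonic a w)) := by
  obtain ⟨M, -, hM⟩ := exists_oscLE a
  exact (cauchySeq_of_le_geometric (7 / 15) M (by norm_num)
    fun n => dist_harmonicApprox_succ_le hM n w).tendsto_limUnder

theorem harmonic_eq (a : Fin 3 → ℝ) (w : ℕ → Fin 6) :
    harmonic a w = harmonic (harmonicStep (w 0) a) (shift w) :=
  tendsto_nhds_unique ((tendsto_add_atTop_iff_nat 1).2 (tendsto_harmonicApprox a w))
    (tendsto_harmonicApprox _ _)

theorem harmonic_mem_Icc {a : Fin 3 → ℝ} {s t : ℝ} (h : ∀ k, a k ∈ Set.Icc s t)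
    (w : ℕ → Fin 6) : harmonic a w ∈ Set.Icc s t :=
  isClosed_Icc.mem_of_tendsto (tendsto_harmonicApprox a w)
    (Eventually.of_forall fun n => harmonicApprox_mem_Icc h n w)

theorem continuous_harmonic (a : Fin 3 → ℝ) : Continuous (harmonic a) := by
  obtain ⟨M, -, hM⟩ := exists_oscLE a
  have hbound (n : ℕ) (w : ℕ → Fin 6) :
      dist (harmonicApprox n a w) (harmonic a w) ≤ M * (7 / 15) ^ n / (1 - 7 / 15) :=
    dist_le_of_le_geometric_of_tendsto (7 / 15) M (by norm_num)
      (fun n => dist_harmonicApprox_succ_le hM n w) (tendsto_harmonicApprox a w) n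
  have hlim : Tendsto (fun n : ℕ => M * (7 / 15 : ℝ) ^ n / (1 - 7 / 15)) atTop (𝓝 0) := by
    have := ((tendsto_pow_atTop_nhds_zero_of_lt_one (r := (7 / 15 : ℝ)) (by norm_num)
      (by norm_num)).const_mul M).div_const (1 - 7 / 15)
    simpa using this
  have hu : TendstoUniformly (fun n => harmonicApprox n a) (harmonic a) atTop := by
    rw [Metric.tendstoUniformly_iff]
    intro ε hε
    filter_upwards [hlim.eventually_lt_const hε] with n hn w
    rw [dist_comm]
    exact (hbound n w).trans_lt hn
  exact hu.continuous (Eventually.of_forall fun n => continuous_harmonicApprox n a).frequently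

/-- Scheme for identities about harmonic functions: a crude bound by a multiple of the oscillation
holds at once, and passing to subcells shrinks the oscillation by `7/15`. The inductions on `n`
below therefore generalize the boundary values and `M`. -/
theorem eq_of_forall_dist_le_geometric {x y M : ℝ}
    (h : ∀ n : ℕ, |x - y| ≤ M * (7 / 15 : ℝ) ^ n) : x = y := by
  have hlim : Tendsto (fun n : ℕ => M * (7 / 15 : ℝ) ^ n) atTop (𝓝 (M * 0)) :=
    (tendsto_pow_atTop_nhds_zero_of_lt_one (by norm_num) (by norm_num)).const_mul M
  have := ge_of_tendsto' hlim h
  rw [mul_zero] at this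
  exact sub_eq_zero.1 (abs_nonpos_iff.1 this)

theorem abs_harmonic_sub_le {a : Fin 3 → ℝ} {M : ℝ} (h : OscLE a M) (w : ℕ → Fin 6)
    (l : Fin 3) : |harmonic a w - a l| ≤ M := by
  have := harmonic_mem_Icc (a := a) (s := a l - M) (t := a l + M)
    (fun n => ⟨by linarith [h l n], by linarith [h n l]⟩) w
  rw [abs_le]
  constructor <;> linarith [this.1, this.2]

theorem harmonic_of_address_eq_q (a : Fin 3 → ℝ) {w : ℕ → Fin 6} {k : Fin 3}
    (hw : address w = q k) : harmonic a w = a k := by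
  obtain ⟨M, -, hM⟩ := exists_oscLE a
  refine eq_of_forall_dist_le_geometric (M := M) fun n => ?_
  induction n generalizing a w M with
  | zero => simpa using abs_harmonic_sub_le hM w k
  | succ n ih =>
    obtain ⟨h0, h1⟩ := address_eq_q hw
    rw [harmonic_eq, h0, ← harmonicStep_corner a k]
    refine (ih _ h1 _ (hM.harmonicStep (corner k))).trans_eq ?_
    ring

theorem harmonic_congr (a : Fin 3 → ℝ) {w w' : ℕ → Fin 6} (h : address w = address w') :
    harmonic a w = harmonic a w' := by
  obtain ⟨M, -, hM⟩ := exists_oscLE a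
  refine eq_of_forall_dist_le_geometric (M := 2 * M) fun n => ?_
  induction n generalizing a w w' M with
  | zero =>
    have h1 := abs_le.1 (abs_harmonic_sub_le hM w 0)
    have h2 := abs_le.1 (abs_harmonic_sub_le hM w' 0)
    rw [abs_le]
    constructor <;> linarith [h1.1, h1.2, h2.1, h2.2]
  | succ n ih =>
    rw [harmonic_eq a w, harmonic_eq a w']
    by_cases h0 : w 0 = w' 0
    · rw [h0]
      refine (ih _ (address_shift_eq h h0) _ (hM.harmonicStep (w' 0))).trans_eq ?_
      ring
    -- The words part here, so both tails sit at vertices and the two values agree exactly by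
    -- compatibility of the extension.
    · obtain ⟨k, l, hk, hl, hF⟩ := exists_address_shift_eq_q h h0
      rw [harmonic_of_address_eq_q _ hk, harmonic_of_address_eq_q _ hl, harmonicStep_congr hF,
        sub_self, abs_zero]
      have : 0 ≤ M := by simpa using hM 0 0
      positivity

/-! ### Harmonic splines -/

/-- The function that is harmonic on all `m`-cells and takes the values `g` at their vertices,
on the space of words. -/
def splineCode : ℕ → (Plane → ℝ) → (ℕ → Fin 6) → ℝ
  | 0, g, w => harmonic (g ∘ q) w
  | m + 1, g, w => splineCode m (g ∘ F (w 0)) (shift w)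

theorem continuous_splineCode (m : ℕ) (g : Plane → ℝ) : Continuous (splineCode m g) := by
  induction m generalizing g with
  | zero => exact continuous_harmonic _
  | succ m ih => exact continuous_of_cases fun i => ih (g ∘ F i)

theorem splineCode_nonneg {g : Plane → ℝ} (hg : ∀ x, 0 ≤ g x) (m : ℕ) (w : ℕ → Fin 6) :
    0 ≤ splineCode m g w := by
  induction m generalizing g w with
  | zero =>
    obtain ⟨C, hC⟩ := (Set.finite_range (g ∘ q)).bddAbove
    exact (harmonic_mem_Icc (fun k => ⟨hg _, hC ⟨k, rfl⟩⟩) w).1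
  | succ m ih => exact ih (fun x => hg _) _

theorem splineCode_of_address_eq_q (m : ℕ) (g : Plane → ℝ) {w : ℕ → Fin 6} {k : Fin 3}
    (hw : address w = q k) : splineCode m g w = g (q k) := by
  induction m generalizing g w with
  | zero => exact harmonic_of_address_eq_q _ hw
  | succ m ih =>
    obtain ⟨h0, h1⟩ := address_eq_q hw
    rw [splineCode, ih _ h1, h0, Function.comp_apply, F_corner_q]

theorem splineCode_factorsThrough (m : ℕ) (g : Plane → ℝ) :
    Function.FactorsThrough (splineCode m g) address := by
  induction m generalizing g with
  | zero => exact fun w w' h => harmonic_congr _ h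
  | succ m ih =>
    intro w w' h
    by_cases h0 : w 0 = w' 0
    · rw [splineCode, splineCode, h0]
      exact ih _ (address_shift_eq h h0)
    · obtain ⟨k, l, hk, hl, hF⟩ := exists_address_shift_eq_q h h0
      rw [splineCode, splineCode, splineCode_of_address_eq_q _ _ hk,
        splineCode_of_address_eq_q _ _ hl, Function.comp_apply, Function.comp_apply, hF]

/-- The function on the gasket that is harmonic on all `m`-cells and takes the values `g` at
their vertices. -/
def spline (m : ℕ) (g : Plane → ℝ) : Plane → ℝ := Function.extend address (splineCode m g) 0

theorem spline_address (m : ℕ) (g : Plane → ℝ) (w : ℕ → Fin 6) :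
    spline m g (address w) = splineCode m g w :=
  (splineCode_factorsThrough m g).extend_apply _ _

theorem continuousOn_spline (m : ℕ) (g : Plane → ℝ) : ContinuousOn (spline m g) gasket := by
  rw [continuousOn_iff_isClosed]
  intro t ht
  -- The word space is compact, so `address` is a closed map and continuity descends from words to
  -- the gasket.
  refine ⟨address '' (splineCode m g ⁻¹' t),
    continuous_address.isClosedMap _ (ht.preimage (continuous_splineCode m g)), ?_⟩
  ext x
  constructor
  · rintro ⟨h, w, rfl⟩
    rw [Set.mem_preimage, spline_address] at h
    exact ⟨⟨w, h, rfl⟩, w, rfl⟩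
  · rintro ⟨⟨w, h, rfl⟩, h'⟩
    exact ⟨by rwa [Set.mem_preimage, spline_address], h'⟩

theorem spline_succ_F (m : ℕ) (g : Plane → ℝ) (i : Fin 6) {x : Plane} (hx : x ∈ gasket) :
    spline (m + 1) g (F i x) = spline m (g ∘ F i) x := by
  obtain ⟨w, rfl⟩ := hx
  rw [← address_cons, spline_address, spline_address]
  rfl

theorem spline_zero_F (g : Plane → ℝ) (i : Fin 6) {x : Plane} (hx : x ∈ gasket)
    {g' : Plane → ℝ} (hg : g' ∘ q = harmonicStep i (g ∘ q)) :
    spline 0 g (F i x) = spline 0 g' x := by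
  obtain ⟨w, rfl⟩ := hx
  rw [← address_cons, spline_address, spline_address, splineCode, splineCode, hg, harmonic_eq]
  rfl

theorem spline_of_mem_V {m : ℕ} (g : Plane → ℝ) {x : Plane} (hx : x ∈ V m) :
    spline m g x = g x := by
  induction m generalizing g x with
  | zero =>
    obtain ⟨k, rfl⟩ := mem_V_zero.1 hx
    obtain ⟨w, hw⟩ := q_mem_gasket k
    rw [← hw, spline_address, splineCode_of_address_eq_q _ _ hw, hw]
  | succ m ih =>
    obtain ⟨i, y, hy, rfl⟩ := mem_V_succ.1 hx
    rw [spline_succ_F _ _ _ (V_subset_gasket hy), ih _ hy, Function.comp_apply]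

/-- By the maximum principle a spline vanishes on a cell unless `g` is nonzero at one of its
vertices, and `m`-cells shrink like `3^(-m)`. -/
theorem exists_dist_le_of_splineCode_ne_zero {D : ℝ}
    (hD : ∀ x ∈ gasket, ∀ k, dist x (q k) ≤ D) (m : ℕ) (g : Plane → ℝ) {w : ℕ → Fin 6}
    (h : splineCode m g w ≠ 0) : ∃ y, g y ≠ 0 ∧ dist (address w) y ≤ D * (1 / 3) ^ m := by
  induction m generalizing g w with
  | zero =>
    by_contra! hc
    refine h ?_
    have h0 : ∀ k, g (q k) = 0 := by
      intro k
      by_contra hk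
      have := hc _ hk
      rw [pow_zero, mul_one] at this
      exact absurd (hD _ (address_mem_gasket w) k) this.not_ge
    have := harmonic_mem_Icc (a := g ∘ q) (s := 0) (t := 0) (fun k => by simp [h0 k]) w
    exact le_antisymm this.2 this.1
  | succ m ih =>
    obtain ⟨y, hy, hd⟩ := ih _ h
    refine ⟨F (w 0) y, hy, ?_⟩
    rw [address_eq_shift, dist_F, pow_succ]
    linarith

/-! ### The energy of a harmonic spline -/

theorem exists_comp_q_eq (a : Fin 3 → ℝ) : ∃ g : Plane → ℝ, g ∘ q = a :=
  ⟨Function.extend q a 0, by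
    funext k
    exact q_injective.extend_apply _ _ _⟩

/-- The harmonic extension has zero graph Laplacian at the seven new vertices, so the values of an
arbitrary `u` there cancel; at the boundary vertices its flux is multiplied by `7/15`. -/
theorem graphEnergy_one_spline_zero (u g : Plane → ℝ) :
    graphEnergy 1 u (spline 0 g) = 7 / 15 * graphEnergy 0 u (spline 0 g) := by
  have hs (i k) : spline 0 g (F i (q k)) = harmonicStep i (g ∘ q) k := by
    obtain ⟨g', hg'⟩ := exists_comp_q_eq (harmonicStep i (g ∘ q))
    rw [spline_zero_F g i (q_mem_gasket k) hg', spline_of_mem_V _ (q_mem_V 0 k), ← hg']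
    rfl
  have hq (k) : spline 0 g (q k) = g (q k) := spline_of_mem_V _ (q_mem_V 0 k)
  -- The eighteen vertices of the six cells are reduced to ten points, so that the unknown values of
  -- `u` cancel in `ring`.
  have e0 : F 0 (q 0) = q 0 := F_corner_q 0
  have e1 : F 1 (q 1) = q 1 := F_corner_q 1
  have e2 : F 2 (q 2) = q 2 := F_corner_q 2
  have e3 : F 0 (q 1) = F 5 (q 0) := (F_q_eq_iff _ _ _ _).2 (by decide)
  have e4 : F 0 (q 2) = F 4 (q 0) := (F_q_eq_iff _ _ _ _).2 (by decide)
  have e5 : F 1 (q 0) = F 5 (q 1) := (F_q_eq_iff _ _ _ _).2 (by decide)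
  have e6 : F 1 (q 2) = F 3 (q 1) := (F_q_eq_iff _ _ _ _).2 (by decide)
  have e7 : F 2 (q 0) = F 4 (q 2) := (F_q_eq_iff _ _ _ _).2 (by decide)
  have e8 : F 2 (q 1) = F 3 (q 2) := (F_q_eq_iff _ _ _ _).2 (by decide)
  have e9 : F 3 (q 0) = F 4 (q 1) := (F_q_eq_iff _ _ _ _).2 (by decide)
  have e10 : F 5 (q 2) = F 4 (q 1) := (F_q_eq_iff _ _ _ _).2 (by decide)
  rw [graphEnergy_succ]
  simp only [graphEnergy_zero, Fin.sum_univ_six, Function.comp_apply, hs, hq, e0, e1, e2, e3, e4,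
    e5, e6, e7, e8, e9, e10]
  simp [harmonicStep, harmonicCoeff]
  ring

theorem graphEnergy_spline_zero (j : ℕ) (u g : Plane → ℝ) :
    graphEnergy j u (spline 0 g) = (7 / 15) ^ j * graphEnergy 0 u (spline 0 g) := by
  induction j generalizing u g with
  | zero => rw [pow_zero, one_mul]
  | succ j ih =>
    choose G hG using fun i => exists_comp_q_eq (harmonicStep i (g ∘ q))
    have hF (n : ℕ) (i) : graphEnergy n (u ∘ F i) (spline 0 g ∘ F i) =
        graphEnergy n (u ∘ F i) (spline 0 (G i)) :=
      graphEnergy_congr (fun _ _ => rfl)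
        fun x hx => spline_zero_F g i (V_subset_gasket hx) (hG i)
    rw [graphEnergy_succ]
    simp only [hF, ih]
    rw [← Finset.mul_sum]
    simp only [← hF]
    rw [← graphEnergy_succ, graphEnergy_one_spline_zero]
    ring

theorem graphEnergy_spline (m j : ℕ) (u g : Plane → ℝ) :
    graphEnergy (m + j) u (spline m g) = (7 / 15) ^ j * graphEnergy m u (spline m g) := by
  induction m generalizing u g with
  | zero => rw [zero_add, graphEnergy_spline_zero]
  | succ m ih =>
    have hF (n : ℕ) (i) : graphEnergy n (u ∘ F i) (spline (m + 1) g ∘ F i) =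
        graphEnergy n (u ∘ F i) (spline m (g ∘ F i)) :=
      graphEnergy_congr (fun _ _ => rfl) fun x hx => spline_succ_F m g i (V_subset_gasket hx)
    rw [Nat.add_right_comm, graphEnergy_succ, graphEnergy_succ, Finset.mul_sum]
    simp only [hF, ih]

theorem renormFactor_eq : renormFactor = 7 / 15 := by
  obtain ⟨g, hg⟩ := exists_comp_q_eq ![1, 0, 0]
  set h := spline 0 g with hh
  have hq (k) : h (q k) = (![1, 0, 0] : Fin 3 → ℝ) k := by
    rw [← hg, hh, spline_of_mem_V _ (q_mem_V 0 k), Function.comp_apply]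
  have hb : HasUnitBoundaryValues h := by simp [HasUnitBoundaryValues, hq]
  -- The pairing with `h` sees only boundary values: `14/15` is `7/15` times the level-zero energy
  -- 2. Minimality of `h` then follows from nonnegativity of the energy of `w - h`.
  have key {w : Plane → ℝ} (hw : HasUnitBoundaryValues w) : graphEnergy 1 w h = 14 / 15 := by
    rw [hh, graphEnergy_one_spline_zero, ← hh, graphEnergy_zero, hw.1, hw.2.1, hw.2.2, hb.1,
      hb.2.1, hb.2.2]
    norm_num
  have hleast : IsLeast {e : ℝ | ∃ w : Plane → ℝ,
      HasUnitBoundaryValues w ∧ e = graphEnergy 1 w w} (14 / 15) := by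
    refine ⟨⟨h, hb, (key hb).symm⟩, ?_⟩
    rintro e ⟨w, hw, rfl⟩
    have h1 := graphEnergy_self_nonneg 1 fun x => w x - h x
    rw [graphEnergy_sub_self, key hw, key hb] at h1
    linarith
  rw [renormFactor, hleast.csInf_eq]
  norm_num

/-- The sequence is stationary from level `m` on, so the limit defining `energy` exists for every
`u` when the other argument is a spline. -/
theorem renormEnergy_spline {m k : ℕ} (hk : m ≤ k) (u g : Plane → ℝ) :
    renormEnergy k u (spline m g) = ((7 / 15) ^ m)⁻¹ * graphEnergy m u (spline m g) := by
  obtain ⟨j, rfl⟩ := Nat.exists_eq_add_of_le hk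
  rw [renormEnergy, renormFactor_eq, graphEnergy_spline, pow_add]
  field_simp

theorem tendsto_renormEnergy_spline (m : ℕ) (u g : Plane → ℝ) :
    Tendsto (fun k => renormEnergy k u (spline m g)) atTop
      (𝓝 (((7 / 15) ^ m)⁻¹ * graphEnergy m u (spline m g))) :=
  tendsto_const_nhds.congr' ((eventually_ge_atTop m).mono fun _ hk =>
    (renormEnergy_spline hk u g).symm)

theorem energy_spline (m : ℕ) (u g : Plane → ℝ) :
    energy u (spline m g) = ((7 / 15) ^ m)⁻¹ * graphEnergy m u (spline m g) :=
  (tendsto_renormEnergy_spline m u g).limUnder_eq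

theorem domEnergy_spline (m : ℕ) (g : Plane → ℝ) : DomEnergy (spline m g) :=
  ⟨continuousOn_spline m g, _, tendsto_renormEnergy_spline m (spline m g) g⟩

/-! ### Integrals -/

theorem integrable_code {G : (ℕ → Fin 6) → ℝ} (hG : Continuous G) : Integrable G bernoulli :=
  hG.integrable_of_hasCompactSupport (HasCompactSupport.of_compactSpace G)

theorem integral_bernoulli {G : (ℕ → Fin 6) → ℝ} (hG : Continuous G) :
    ∫ w, G w ∂bernoulli = 1 / 6 * ∑ i, ∫ w, G (cons i w) ∂bernoulli := by
  have hm (i) : ∫ w, G w ∂bernoulli.map (cons i) = ∫ w, G (cons i w) ∂bernoulli :=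
    integral_map (measurable_cons i).aemeasurable hG.aestronglyMeasurable
  have hi (i) : Integrable G (bernoulli.map (cons i)) := by
    have := Measure.isProbabilityMeasure_map (μ := bernoulli) (measurable_cons i).aemeasurable
    exact hG.integrable_of_hasCompactSupport (HasCompactSupport.of_compactSpace G)
  conv_lhs => rw [← bernoulli_eq]
  rw [integral_smul_measure, integral_finsetSum_measure fun i _ => hi i]
  simp only [hm]
  simp

theorem setIntegral_gasket {G : Plane → ℝ} (hG : ContinuousOn G gasket) :
    ∫ x in gasket, G x ∂standardMeasure = ∫ w, G (address w) ∂bernoulli := by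
  have hr : standardMeasure.restrict gasket = standardMeasure := by
    rw [Measure.restrict_eq_self_of_ae_mem]
    have h := standardMeasure_gasket
    rwa [prob_compl_eq_zero_iff isCompact_gasket.measurableSet |>.symm] at h
  have hm := hG.aestronglyMeasurable (μ := standardMeasure) isCompact_gasket.measurableSet
  rw [hr] at hm ⊢
  exact integral_map continuous_address.measurable.aemeasurable hm

/-- Both sides obey the same self-similar averaging over the six cells (`hmean` for the right side),
so their difference contracts with the oscillation. -/
theorem integral_harmonic (a : Fin 3 → ℝ) :
    ∫ w, harmonic a w ∂bernoulli = (a 0 + a 1 + a 2) / 3 := by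
  obtain ⟨M, -, hM⟩ := exists_oscLE a
  refine eq_of_forall_dist_le_geometric (M := M) fun n => ?_
  induction n generalizing a M with
  | zero =>
    have hb (w : ℕ → Fin 6) : ‖harmonic a w - (a 0 + a 1 + a 2) / 3‖ ≤ M := by
      have h0 := abs_le.1 (abs_harmonic_sub_le hM w 0)
      have h1 := abs_le.1 (abs_harmonic_sub_le hM w 1)
      have h2 := abs_le.1 (abs_harmonic_sub_le hM w 2)
      rw [Real.norm_eq_abs, abs_le]
      constructor <;> linarith [h0.1, h0.2, h1.1, h1.2, h2.1, h2.2]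
    have := norm_integral_le_of_norm_le_const (μ := bernoulli) (Eventually.of_forall hb)
    rw [integral_sub (integrable_code (continuous_harmonic a)) (integrable_const _)] at this
    simpa using this
  | succ n ih =>
    have hc (i w) : harmonic a (cons i w) = harmonic (harmonicStep i a) w := harmonic_eq a _
    have hmean : (a 0 + a 1 + a 2) / 3 =
        1 / 6 * ∑ i, (harmonicStep i a 0 + harmonicStep i a 1 + harmonicStep i a 2) / 3 := by
      rw [Fin.sum_univ_six]
      simp [harmonicStep, harmonicCoeff]
      ring
    rw [integral_bernoulli (continuous_harmonic a), hmean, ← mul_sub, ← Finset.sum_sub_distrib,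
      abs_mul]
    simp only [hc]
    have h1 := (Finset.abs_sum_le_sum_abs (fun i => ∫ w, harmonic (harmonicStep i a) w ∂bernoulli -
      (harmonicStep i a 0 + harmonicStep i a 1 + harmonicStep i a 2) / 3) Finset.univ).trans
      (Finset.sum_le_sum fun i _ => ih _ _ (hM.harmonicStep i))
    rw [Finset.sum_const, Finset.card_univ, Fintype.card_fin, nsmul_eq_mul] at h1
    rw [abs_of_pos (by norm_num : (0 : ℝ) < 1 / 6), pow_succ]
    push_cast at h1
    linarith

/-- The energy of an indicator function of a vertex, that is its degree, is a multiple of the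
integral of the corresponding spline. -/
theorem graphEnergy_self_eq_integral {g : Plane → ℝ} (hg : ∀ x, g x = 0 ∨ g x = 1)
    (hg' : ∀ x y, g x ≠ 0 → g y ≠ 0 → x = y) (m : ℕ) :
    graphEnergy m g g = 6 ^ (m + 1) * ∫ w, splineCode m g w ∂bernoulli := by
  induction m generalizing g with
  | zero =>
    have hne {k l : Fin 3} (hkl : k ≠ l) : g (q k) = 0 ∨ g (q l) = 0 := by
      by_contra! h
      exact hkl (q_injective (hg' _ _ h.1 h.2))
    have h01 := hne (k := 0) (l := 1) (by decide)
    have h02 := hne (k := 0) (l := 2) (by decide)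
    have h12 := hne (k := 1) (l := 2) (by decide)
    simp only [splineCode]
    rw [graphEnergy_zero, integral_harmonic]
    simp only [Function.comp_apply]
    -- Either all three values vanish, or exactly one is 1 and the identity reads `2 = 6 · (1/3)`.
    rcases hg (q 0) with h0 | h0 <;> rcases hg (q 1) with h1 | h1 <;>
      rcases hg (q 2) with h2 | h2 <;> simp [h0, h1, h2] at h01 h02 h12 ⊢ <;> norm_num
  | succ m ih =>
    -- Restriction to a cell preserves the hypotheses, even where it is identically zero; this is
    -- why `g` is not fixed as the indicator of a vertex.
    have hi (i : Fin 6) := ih (g := g ∘ F i) (fun x => hg _)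
      fun x y hx hy => F_injective i (hg' _ _ hx hy)
    rw [graphEnergy_succ, integral_bernoulli (continuous_splineCode _ _), Finset.sum_congr rfl
      fun i _ => hi i, ← Finset.mul_sum, pow_succ]
    simp only [splineCode]
    have hc (i w) : shift (cons i w) = w := rfl
    simp only [hc, cons]
    ring

/-! ### The pointwise formula -/

open Classical in
/-- The spline of level `m` that is `1` at the vertex `p` and `0` at all others. -/
def tent (m : ℕ) (p : Plane) : Plane → ℝ := spline m (Pi.single p 1)

theorem deg_eq_integral_tent {m : ℕ} {p : Plane} (hp : p ∈ V m) :
    (deg m p : ℝ) = 6 ^ (m + 1) * ∫ w, tent m p (address w) ∂bernoulli := by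
  classical
  have hne {x : Plane} (hx : x ≠ p) : (Pi.single p 1 : Plane → ℝ) x = 0 :=
    Pi.single_eq_of_ne hx 1
  have h1 : (Pi.single p 1 : Plane → ℝ) p = 1 := Pi.single_eq_same p 1
  have h := graphEnergy_self_eq_integral (g := Pi.single p 1)
    (fun x => by
      by_cases hx : x = p
      · exact Or.inr (hx ▸ h1)
      · exact Or.inl (hne hx))
    (fun x y hx hy => (not_imp_comm.1 hne hx).trans (not_imp_comm.1 hne hy).symm) m
  rw [graphEnergy_single _ hp h1 fun x _ hx => hne hx] at h
  simp only [tent, spline_address]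
  rw [Finset.sum_congr rfl fun y hy => by
    rw [h1, hne (mem_neighbors.1 hy).ne.symm, sub_zero]] at h
  convert h using 1
  · simp [deg]

theorem graphLaplacian_eq {u f : Plane → ℝ} (hu : IsLaplacian u f) {m : ℕ} {p : Plane}
    (hp : p ∈ V m) (hp0 : p ∉ V 0) :
    6 * ((90 / 7 : ℝ) ^ m * graphLaplacian m u p) =
      (∫ w, f (address w) * tent m p (address w) ∂bernoulli) /
        ∫ w, tent m p (address w) ∂bernoulli := by
  classical
  -- The tent is an admissible test function because `p` is not a boundary vertex.
  have hdom : DomEnergyZero (tent m p) := by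
    refine ⟨domEnergy_spline m _, fun x hx => ?_⟩
    obtain ⟨k, rfl⟩ := mem_V_zero.1 hx
    rw [tent, spline_of_mem_V _ (q_mem_V m k)]
    exact Pi.single_eq_of_ne (ne_of_mem_of_not_mem hx hp0) 1
  have h := hu.2.2 _ hdom
  rw [setIntegral_gasket (G := fun x => f x * tent m p x)
    (hu.2.1.mul (continuousOn_spline m _))] at h
  have hE : graphEnergy m u (tent m p) = ∑ y ∈ neighbors m p, (u p - u y) := by
    refine graphEnergy_single u hp ?_ fun x hx hxp => ?_
    · rw [tent, spline_of_mem_V _ hp, Pi.single_eq_same]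
    · rw [tent, spline_of_mem_V _ hx, Pi.single_eq_of_ne hxp]
  rw [tent, energy_spline, ← tent, hE] at h
  have hdeg := deg_eq_integral_tent hp
  have hpos : (0 : ℝ) < deg m p := by exact_mod_cast deg_pos hp
  have hneg : ∑ y ∈ neighbors m p, (u y - u p) = -∑ y ∈ neighbors m p, (u p - u y) := by
    rw [← Finset.sum_neg_distrib]
    exact Finset.sum_congr rfl fun y _ => by ring
  have hI : ∫ w, tent m p (address w) ∂bernoulli ≠ 0 := by
    intro h0
    rw [h0, mul_zero] at hdeg
    exact hpos.ne' hdeg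
  rw [graphLaplacian, hneg, hdeg]
  -- `6^m` is the measure scaling and the inverse power the energy scaling; the sixth factor 6 in
  -- `6^(m+1)` of `hdeg` cancels the 6 in front of the Laplacian.
  have h90 : (90 / 7 : ℝ) ^ m = 6 ^ m * ((7 / 15 : ℝ) ^ m)⁻¹ := by
    rw [← inv_pow, ← mul_pow]
    norm_num
  set S := ∑ y ∈ neighbors m p, (u p - u y)
  rw [h90, pow_succ]
  have hint : (∫ w, f (address w) * tent m p (address w) ∂bernoulli) =
      -(((7 / 15 : ℝ) ^ m)⁻¹ * S) := by
    rw [h, neg_neg]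
  rw [hint]
  field_simp

/-! ### Tents as weights concentrating at their vertex -/

theorem tent_address_nonneg (m : ℕ) (p : Plane) (w : ℕ → Fin 6) : 0 ≤ tent m p (address w) := by
  classical
  rw [tent, spline_address]
  exact splineCode_nonneg (fun x => (Pi.single_nonneg.2 zero_le_one : (0 : Plane → ℝ) ≤ _) x) _ _

theorem continuous_tent_address (m : ℕ) (p : Plane) :
    Continuous fun w => tent m p (address w) := by
  simp only [tent, spline_address]
  exact continuous_splineCode m _

theorem exists_dist_address_le : ∃ D : ℝ, ∀ m p w, tent m p (address w) ≠ 0 →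
    dist (address w) p ≤ D * (1 / 3) ^ m := by
  classical
  obtain ⟨D, hD⟩ := Metric.isBounded_iff.1 isCompact_gasket.isBounded
  refine ⟨D, fun m p w h => ?_⟩
  rw [tent, spline_address] at h
  obtain ⟨y, hy, hd⟩ := exists_dist_le_of_splineCode_ne_zero
    (fun x hx k => hD hx (q_mem_gasket k)) m _ h
  obtain rfl : y = p := by
    by_contra hyp
    exact hy (Pi.single_eq_of_ne hyp 1)
  exact hd

theorem continuous_comp_address {f : Plane → ℝ} (hf : ContinuousOn f gasket) :
    Continuous fun w => f (address w) :=
  hf.comp_continuous continuous_address address_mem_gasket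

/-- A weighted mean of values that are close to `c` is close to `c`. -/
theorem abs_integral_div_sub_le {f v : (ℕ → Fin 6) → ℝ} (hf : Continuous f) (hv : Continuous v)
    (hv0 : ∀ w, 0 ≤ v w) (hI : 0 < ∫ w, v w ∂bernoulli) {c ε : ℝ}
    (h : ∀ w, v w ≠ 0 → |f w - c| ≤ ε) :
    |(∫ w, f w * v w ∂bernoulli) / (∫ w, v w ∂bernoulli) - c| ≤ ε := by
  have e : (∫ w, f w * v w ∂bernoulli) / (∫ w, v w ∂bernoulli) - c =
      (∫ w, (f w - c) * v w ∂bernoulli) / ∫ w, v w ∂bernoulli := by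
    simp only [sub_mul]
    rw [integral_sub (f := fun w => f w * v w) (g := fun w => c * v w)
        (integrable_code (hf.mul hv)) (integrable_code (continuous_const.mul hv)),
      integral_const_mul, sub_div, mul_div_cancel_right₀ _ hI.ne']
  rw [e, abs_div, abs_of_pos hI, div_le_iff₀ hI, ← integral_const_mul, ← Real.norm_eq_abs]
  refine norm_integral_le_of_norm_le (integrable_code (continuous_const.mul hv))
    (Eventually.of_forall fun w => ?_)
  rw [Real.norm_eq_abs, abs_mul, abs_of_nonneg (hv0 w)]
  by_cases hw : v w = 0
  · simp [hw]
  · exact mul_le_mul_of_nonneg_right (h w hw) (hv0 w)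

end SG3

end

theorem mainTheorem9 (u f : SG3.Plane → ℝ) (hu : SG3.IsLaplacian u f)
    (x : SG3.Plane) (hx : x ∈ SG3.gasket)
    (xs : ℕ → SG3.Plane) (hxs : ∀ m, xs m ∈ SG3.V m) (hint : ∀ᶠ m in atTop, xs m ∉ SG3.V 0)
    (hlim : Tendsto xs atTop (𝓝 x)) :
    Tendsto (fun m : ℕ => 6 * ((90 / 7 : ℝ) ^ m * SG3.graphLaplacian m u (xs m))) atTop
      (𝓝 (f x)) := by
  obtain ⟨D, hD⟩ := SG3.exists_dist_address_le
  rw [Metric.tendsto_nhds]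
  intro ε hε
  -- Half of `ε`, because the weighted mean inherits only a non-strict bound.
  obtain ⟨δ, hδ, hf⟩ := Metric.continuousOn_iff.1 hu.2.1 x hx (ε / 2) (half_pos hε)
  have hsmall : Tendsto (fun m => D * (1 / 3 : ℝ) ^ m + dist (xs m) x) atTop (𝓝 0) := by
    have h1 := (tendsto_pow_atTop_nhds_zero_of_lt_one (r := (1 / 3 : ℝ)) (by norm_num)
      (by norm_num)).const_mul D
    simpa using h1.add (tendsto_iff_dist_tendsto_zero.1 hlim)
  filter_upwards [hint, hsmall.eventually_lt_const hδ] with m hm hmδ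
  have hI : 0 < ∫ w, SG3.tent m (xs m) (SG3.address w) ∂SG3.bernoulli := by
    have h1 := SG3.deg_eq_integral_tent (hxs m)
    have h2 : (0 : ℝ) < SG3.deg m (xs m) := by exact_mod_cast SG3.deg_pos (hxs m)
    rw [h1] at h2
    exact pos_of_mul_pos_right h2 (by positivity)
  rw [SG3.graphLaplacian_eq hu (hxs m) hm, Real.dist_eq]
  refine (SG3.abs_integral_div_sub_le (SG3.continuous_comp_address hu.2.1)
    (SG3.continuous_tent_address m (xs m)) (SG3.tent_address_nonneg m (xs m)) hI
    (ε := ε / 2) fun w hw => ?_).trans_lt (half_lt_self hε)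
  refine (hf _ (SG3.address_mem_gasket w) ?_).le
  exact ((dist_triangle _ (xs m) _).trans (add_le_add_left (hD _ _ _ hw) _)).trans_lt hmδ
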